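/- **Setting.** There are $A\ge 1$ base algorithms $a^1,\dots,a^A$; algorithm $a^j$ owns a finite nonempty policy set $\mathcal X^j$ and maps its history (the chronological list of the (policy, reward) pairs on which it received feedback) to a, possibly randomized, policy in $\mathcal X^j$. The reward functions $f_1,\dots,f_T$ with values in $[0,1]$ are an arbitrary fixed sequence. MetBS with parameter $\eta\in(0,1]$ starts with weights $w_1(j)=1$ and empty histories. In round $t$ it samples $i_t$ from $y_t(j)=\frac{\eta}{A}+(1-\eta)\frac{w_t(j)}{\sum_{j'}w_t(j')}$, deploys the policy $x_t$ that $a^{i_t}$ proposes from its history, and receives $f_t(x_t)$. It then sets $w_{t+1}(j)=w_t(j)\exp(\eta\Phi_t(j)/A)$, where $\Phi_t(i_t)=f_t(x_t)/y_t(i_t)$ and $\Phi_t(j)=0$ for $j\ne i_t$. With probability $\eta/(A\,y_t(i_t))$ it appends $(x_t,f_t(x_t))$ to the history of $a^{i_t}$; otherwise no history changes. Let $\rho=\eta/A$. Let $G_T(j)=\sum_{t=1}^T\mathbb E[f_t(a^j(h_t^{j}))]$ be the expected reward of $a^j$ when in every round the feedback on its proposed policy is kept in its history $h^j_t$ independently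 with probability $\rho$. Let $i^*$ be a best algorithm, i.e. a maximizer of $G_T$. The regret of MetBS is $\mathcal R_T=\max_{x\in\mathcal X^{i^*}}\sum_{t=1}^T f_t(x)-\mathbb E\big[\sum_{t=1}^T f_t(x_t)\big]$. **Lemma.** Let $\beta\in[0,1]$ and let $c_1,c_2,K>0$. There is a constant $C>0$, depending only on $\beta,c_1,c_2,K$, such that the following holds for every horizon $T\ge1$, every $A\ge1$, all base algorithms, all reward sequences and every $\beta^{*}\in[0,\beta]$. Suppose that $$\max_{x\in\mathcal X^{i^*}}\sum_{t=1}^T f_t(x)-G_T(i^*)\le K\,\frac{(\rho T)^{\beta^{*}}}{\rho},$$ and that $\eta\in(0,1]$ is of order $g=T^{-\frac{1-\beta}{2-\beta}}A^{\frac{1-\beta}{2-\beta}}(\log A)^{\frac12\mathbf 1[\beta=0]}$, in the sense that $c_1 g\le\eta\le c_2 g$ (for $\beta=0$ this forces $A\ge2$; $(\log A)^0=1$). Then $$\mathcal R_T\le C\,T^{\frac1{2-\beta}}A^{\frac1{2-\beta}}(\log A)^{\frac12\mathbf 1[\beta=0]}.$$ If $\beta<1$, this bound is sublinear in $T$: for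 every fixed $A$ it is $o(T)$ as $T\to\infty$. -/

import Mathlib

open Filter Asymptotics

namespace MetBS

noncomputable section

universe u

/-! ### Elementary discrete probability -/

/-- Expected value of a real function under a probability mass function.
It is only used below for functions with values in `[0, 1]`, for which the sum converges. -/
def expect {α : Type u} (p : PMF α) (g : α → ℝ) : ℝ := ∑' a, (p a).toReal * g a

/-- The Bernoulli law on `{true, false}` giving mass `p` to `true`. -/
def coin (p : ℝ) (h0 : 0 ≤ p) (h1 : p ≤ 1) : PMF Bool :=
  PMF.ofFintype (fun b => ENNReal.ofReal (cond b p (1 - p))) (by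
    rw [Fintype.sum_bool]
    simp only [cond_true, cond_false]
    rw [← ENNReal.ofReal_add h0 (by linarith)]
    simp)

/-! ### Base algorithms -/

/-- A history: the (policy, reward) pairs on which an algorithm has received feedback so far,
in chronological order. -/
abbrev History (X : Type u) : Type u := List (X × ℝ)

/-- A (possibly randomized) base algorithm: it owns a finite nonempty set of policies and maps
the history available to it to a (law of a) proposed policy from that set. -/
structure BaseAlgorithm (X : Type u) where
  policies : Finset X
  nonempty : policies.Nonempty
  propose : History X → PMF X
  propose_mem : ∀ h : History X, ∀ x ∈ (propose h).support, x ∈ policies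

/-- Cumulative reward of the best single policy of the algorithm `a` over the `T` rounds
`0, …, T - 1`. -/
def bestPolicyReward {X : Type u} (a : BaseAlgorithm X) (f : ℕ → X → ℝ) (T : ℕ) : ℝ :=
  a.policies.sup' a.nonempty (fun x => ∑ t ∈ Finset.range T, f t x)

/-! ### A base algorithm run on sparse feedback -/

/-- Law of the sparse history of `a` at the beginning of round `t`, when in each round the
feedback on the proposed policy is kept with probability `ρ` (an independent coin `ξ`) and
blocked otherwise. -/
def sparseHistoryLaw {X : Type u} (a : BaseAlgorithm X) (f : ℕ → X → ℝ)
    (ρ : ℝ) (h0 : 0 ≤ ρ) (h1 : ρ ≤ 1) : ℕ → PMF (History X)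
  | 0 => PMF.pure []
  | t + 1 =>
    (sparseHistoryLaw a f ρ h0 h1 t).bind fun h =>
      (a.propose h).bind fun x =>
        (coin ρ h0 h1).bind fun ξ =>
          PMF.pure (if ξ then h ++ [(x, f t x)] else h)

/-- Aggregate expected reward `∑ₜ E[fₜ(a(hₜ))]` of `a` over `T` rounds, its feedback being kept
at rate `ρ`. -/
def sparseReward {X : Type u} (a : BaseAlgorithm X) (f : ℕ → X → ℝ)
    (ρ : ℝ) (h0 : 0 ≤ ρ) (h1 : ρ ≤ 1) (T : ℕ) : ℝ :=
  ∑ t ∈ Finset.range T, expect ((sparseHistoryLaw a f ρ h0 h1 t).bind a.propose) (f t)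

/-! ### The meta-learner -/

/-- State of the meta-learner at the beginning of a round: the (positive) Exp3 weights of the
`A` base algorithms and the sparse history of each of them. -/
structure State (X : Type u) (A : ℕ) where
  w : Fin A → ℝ
  w_pos : ∀ j, 0 < w j
  hist : Fin A → History X

/-- Initially all weights are `1` and all histories are empty. -/
def State.init (X : Type u) (A : ℕ) : State X A where
  w := fun _ => 1
  w_pos := fun _ => one_pos
  hist := fun _ => []

variable {X : Type u} {A : ℕ}

/-- The explore/exploit probability `y(j) = η / A + (1 - η) w(j) / ∑ w`. -/
def selProb (η : Set.Ioc (0 : ℝ) 1) (s : State X A) (j : Fin A) : ℝ :=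
  (η : ℝ) / A + (1 - (η : ℝ)) * (s.w j / ∑ k, s.w k)

theorem eta_div_pos (η : Set.Ioc (0 : ℝ) 1) (j : Fin A) : 0 < (η : ℝ) / A :=
  div_pos η.2.1 (by exact_mod_cast j.pos)

theorem eta_div_nonneg (η : Set.Ioc (0 : ℝ) 1) (A : ℕ) : 0 ≤ (η : ℝ) / A :=
  div_nonneg η.2.1.le (Nat.cast_nonneg A)

theorem eta_div_le_one (η : Set.Ioc (0 : ℝ) 1) (A : ℕ) : (η : ℝ) / A ≤ 1 := by
  rcases Nat.eq_zero_or_pos A with h | h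
  · simp [h]
  · have : (1 : ℝ) ≤ A := by exact_mod_cast h
    rw [div_le_one (by linarith)]
    exact η.2.2.trans this

theorem eta_div_le_selProb (η : Set.Ioc (0 : ℝ) 1) (s : State X A) (j : Fin A) :
    (η : ℝ) / A ≤ selProb η s j := by
  have h1 : 0 ≤ 1 - (η : ℝ) := sub_nonneg.2 η.2.2
  have h2 : 0 ≤ s.w j / ∑ k, s.w k :=
    div_nonneg (s.w_pos j).le (Finset.sum_nonneg fun k _ => (s.w_pos k).le)
  have := mul_nonneg h1 h2
  unfold selProb
  linarith

theorem selProb_pos (η : Set.Ioc (0 : ℝ) 1) (s : State X A) (j : Fin A) :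
    0 < selProb η s j :=
  (eta_div_pos η j).trans_le (eta_div_le_selProb η s j)

theorem sum_selProb [NeZero A] (η : Set.Ioc (0 : ℝ) 1) (s : State X A) :
    ∑ j, selProb η s j = 1 := by
  have hA : (A : ℝ) ≠ 0 := by exact_mod_cast NeZero.ne A
  have hw : ∑ k, s.w k ≠ 0 :=
    (Finset.sum_pos (fun k _ => s.w_pos k) Finset.univ_nonempty).ne'
  have hs : ∑ j, s.w j / ∑ k, s.w k = 1 := by rw [← Finset.sum_div, div_self hw]
  unfold selProb
  rw [Finset.sum_add_distrib, ← Finset.mul_sum, hs]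
  simp only [Finset.sum_const, Finset.card_univ, Fintype.card_fin, nsmul_eq_mul]
  field_simp
  ring

/-- The law `y` from which the meta-learner samples the base algorithm. -/
def selLaw [NeZero A] (η : Set.Ioc (0 : ℝ) 1) (s : State X A) : PMF (Fin A) :=
  PMF.ofFintype (fun j => ENNReal.ofReal (selProb η s j)) (by
    rw [← ENNReal.ofReal_sum_of_nonneg (fun j _ => (selProb_pos η s j).le), sum_selProb]
    simp)

/-- Probability `η / (A y(i))` with which the feedback of the selected algorithm `i` is kept. -/
def keepProb (η : Set.Ioc (0 : ℝ) 1) (s : State X A) (i : Fin A) : ℝ :=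
  (η : ℝ) / (A * selProb η s i)

theorem keepProb_nonneg (η : Set.Ioc (0 : ℝ) 1) (s : State X A) (i : Fin A) :
    0 ≤ keepProb η s i :=
  div_nonneg η.2.1.le (mul_nonneg (Nat.cast_nonneg A) (selProb_pos η s i).le)

theorem keepProb_le_one (η : Set.Ioc (0 : ℝ) 1) (s : State X A) (i : Fin A) :
    keepProb η s i ≤ 1 := by
  unfold keepProb
  rw [← div_div]
  exact (div_le_one (selProb_pos η s i)).2 (eta_div_le_selProb η s i)

/-- Importance-weighted feedback of algorithm `j` when algorithm `i` was selected and the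
deployed policy returned the reward `r`. -/
def feedback (η : Set.Ioc (0 : ℝ) 1) (s : State X A) (i : Fin A) (r : ℝ) (j : Fin A) : ℝ :=
  if j = i then r / selProb η s i else 0

/-- The state after a round in which algorithm `i` was selected, its policy `x` returned the
reward `r`, and the feedback bit was `ξ`. -/
def State.next (η : Set.Ioc (0 : ℝ) 1) (s : State X A) (i : Fin A) (x : X) (r : ℝ) (ξ : Bool) :
    State X A where
  w := fun j => s.w j * Real.exp ((η : ℝ) * feedback η s i r j / A)
  w_pos := fun j => mul_pos (s.w_pos j) (Real.exp_pos _)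
  hist := if ξ then Function.update s.hist i (s.hist i ++ [(x, r)]) else s.hist

/-- Law of the state at the beginning of round `t`. In each round: sample the algorithm
`i ∼ y`, let it propose `x` from its sparse history, observe the reward `f t x`, sample the
feedback bit `ξ` with parameter `η / (A y(i))`, and update. -/
def stateLaw [NeZero A] (alg : Fin A → BaseAlgorithm X) (f : ℕ → X → ℝ)
    (η : Set.Ioc (0 : ℝ) 1) : ℕ → PMF (State X A)
  | 0 => PMF.pure (State.init X A)
  | t + 1 =>
    (stateLaw alg f η t).bind fun s =>
      (selLaw η s).bind fun i =>
        ((alg i).propose (s.hist i)).bind fun x =>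
          (coin (keepProb η s i) (keepProb_nonneg η s i) (keepProb_le_one η s i)).bind fun ξ =>
            PMF.pure (s.next η i x (f t x) ξ)

/-- Law of the policy deployed by the meta-learner in round `t`. -/
def deployedLaw [NeZero A] (alg : Fin A → BaseAlgorithm X) (f : ℕ → X → ℝ)
    (η : Set.Ioc (0 : ℝ) 1) (t : ℕ) : PMF X :=
  (stateLaw alg f η t).bind fun s =>
    (selLaw η s).bind fun i => (alg i).propose (s.hist i)

/-- Expected cumulative reward of the meta-learner over `T` rounds. -/
def metaReward [NeZero A] (alg : Fin A → BaseAlgorithm X) (f : ℕ → X → ℝ)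
    (η : Set.Ioc (0 : ℝ) 1) (T : ℕ) : ℝ :=
  ∑ t ∈ Finset.range T, expect (deployedLaw alg f η t) (f t)

/-- Aggregate expected reward of base algorithm `j` when its feedback is kept at rate
`ρ = η / A`. -/
def algReward (alg : Fin A → BaseAlgorithm X) (f : ℕ → X → ℝ)
    (η : Set.Ioc (0 : ℝ) 1) (T : ℕ) (j : Fin A) : ℝ :=
  sparseReward (alg j) f ((η : ℝ) / A) (eta_div_nonneg η A) (eta_div_le_one η A) T

/-- Algorithm `i` is a best algorithm: it maximizes the aggregate expected reward. -/
def IsBestAlgorithm (alg : Fin A → BaseAlgorithm X) (f : ℕ → X → ℝ)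
    (η : Set.Ioc (0 : ℝ) 1) (T : ℕ) (i : Fin A) : Prop :=
  ∀ j, algReward alg f η T j ≤ algReward alg f η T i

/-- Regret of algorithm `i`, fed at rate `η / A`, with respect to its best single policy. -/
def algRegret (alg : Fin A → BaseAlgorithm X) (f : ℕ → X → ℝ)
    (η : Set.Ioc (0 : ℝ) 1) (T : ℕ) (i : Fin A) : ℝ :=
  bestPolicyReward (alg i) f T - algReward alg f η T i

/-- Expected regret of the meta-learner with respect to the best single policy of
algorithm `i`. -/
def metaRegret [NeZero A] (alg : Fin A → BaseAlgorithm X) (f : ℕ → X → ℝ)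
    (η : Set.Ioc (0 : ℝ) 1) (T : ℕ) (i : Fin A) : ℝ :=
  bestPolicyReward (alg i) f T - metaReward alg f η T

/-! ### The rates -/

/-- `(log A) ^ (1/2 · 1[β = 0])`. -/
def logFactor (β : ℝ) (A : ℕ) : ℝ := Real.log A ^ ((1 / 2 : ℝ) * (if β = 0 then 1 else 0))

/-- `T ^ (-(1-β)/(2-β)) · A ^ ((1-β)/(2-β)) · (log A) ^ (1/2 · 1[β = 0])`. -/
def etaRate (β : ℝ) (T A : ℕ) : ℝ :=
  (T : ℝ) ^ (-((1 - β) / (2 - β))) * (A : ℝ) ^ ((1 - β) / (2 - β)) * logFactor β A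

/-- `T ^ (1/(2-β)) · A ^ (1/(2-β)) · (log A) ^ (1/2 · 1[β = 0])`. -/
def regretRate (β : ℝ) (T A : ℕ) : ℝ :=
  (T : ℝ) ^ (1 / (2 - β)) * (A : ℝ) ^ (1 / (2 - β)) * logFactor β A

end

end MetBS

open MetBS

/-! With `ρ = η / A`, the regret against `i` is the regret of `i` itself fed at rate `ρ`, plus the
gap between its reward and that of the meta-learner. An algorithm is selected with probability `y`
and its feedback kept with probability `ρ / y`, so from any state it gains feedback with probability
exactly `ρ`. Its history under MetBS therefore has the law of a history fed at constant rate `ρ`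
(`expect_stateLaw_hist`), although the weights depend on the past. Importance weighting then makes
the expected log-weight of `j` equal to `ρ` times its standalone reward (`expect_log_w`). Comparing
this with the growth of the log of the total weight, as for Exp3, bounds the gap by `2ηT + (A/η) log
A` (`algReward_sub_metaReward_le`). Tuning remains (`exists_rate_constant`). For `0 < β < 1` no
logarithm survives: `η ≤ 1` forces `A` to be at most a constant times `T`, so `log A` is absorbed by
a power of `T`. For `β = 0` the factor `√(log A)` balances the two terms. For `β = 1` the bound is
trivial. -/

namespace MetBS

universe u v

/-! ### Expectations under finitely supported laws. -/

section Expect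

variable {α : Type u} {β : Type v}

/-- Every law in the model has finite support, so this reduction removes all summability questions,
even for unbounded functions such as log-weights. -/
theorem expect_eq_sum {p : PMF α} {S : Finset α} (hS : p.support ⊆ S) (g : α → ℝ) :
    expect p g = ∑ a ∈ S, (p a).toReal * g a := by
  unfold expect
  refine tsum_eq_sum fun a ha => ?_
  have : p a = 0 := by
    by_contra h
    exact ha (hS ((PMF.mem_support_iff p a).2 h))
  simp [this]

theorem expect_fintype [Fintype α] (p : PMF α) (g : α → ℝ) :
    expect p g = ∑ a, (p a).toReal * g a :=
  expect_eq_sum (by simp) g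

theorem expect_pure (a : α) (g : α → ℝ) : expect (PMF.pure a) g = g a := by
  rw [expect_eq_sum (S := {a}) (by simp)]
  simp

theorem finite_support_bind {p : PMF α} {q : α → PMF β} (hp : p.support.Finite)
    (hq : ∀ a, (q a).support.Finite) : (p.bind q).support.Finite := by
  rw [PMF.support_bind]
  exact hp.biUnion fun a _ => hq a

theorem finite_support_pure (a : α) : (PMF.pure a).support.Finite := by
  simp

theorem sum_toReal_eq_one {p : PMF α} {S : Finset α} (hS : p.support ⊆ S) :
    ∑ a ∈ S, (p a).toReal = 1 := by
  rw [← ENNReal.toReal_sum fun a _ => p.apply_ne_top a, (PMF.hasSum_coe_one p |>.tsum_eq ▸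
    (tsum_eq_sum (s := S) fun a ha => ?_).symm : ∑ a ∈ S, p a = 1)]
  · simp
  · by_contra h
    exact ha (hS ((PMF.mem_support_iff p a).2 h))

theorem expect_const (p : PMF α) (hp : p.support.Finite) (c : ℝ) :
    expect p (fun _ => c) = c := by
  have hS : p.support ⊆ hp.toFinset := by simp
  rw [expect_eq_sum hS, ← Finset.sum_mul, sum_toReal_eq_one hS, one_mul]

theorem expect_add (p : PMF α) (hp : p.support.Finite) (g h : α → ℝ) :
    expect p (fun a => g a + h a) = expect p g + expect p h := by
  have hS : p.support ⊆ hp.toFinset := by simp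
  simp only [expect_eq_sum hS, mul_add, Finset.sum_add_distrib]

theorem expect_const_mul (p : PMF α) (c : ℝ) (g : α → ℝ) :
    expect p (fun a => c * g a) = c * expect p g := by
  unfold expect
  rw [← tsum_mul_left]
  exact tsum_congr fun a => by ring

theorem expect_mono (p : PMF α) (hp : p.support.Finite) {g h : α → ℝ} (hgh : ∀ a, g a ≤ h a) :
    expect p g ≤ expect p h := by
  have hS : p.support ⊆ hp.toFinset := by simp
  rw [expect_eq_sum hS, expect_eq_sum hS]
  exact Finset.sum_le_sum fun a _ => mul_le_mul_of_nonneg_left (hgh a) ENNReal.toReal_nonneg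

theorem expect_bind (p : PMF α) (q : α → PMF β) (hp : p.support.Finite)
    (hq : ∀ a, (q a).support.Finite) (g : β → ℝ) :
    expect (p.bind q) g = expect p (fun a => expect (q a) g) := by
  classical
  have hS : p.support ⊆ hp.toFinset := by simp
  set U : Finset β := hp.toFinset.biUnion fun a => (hq a).toFinset with hU
  have hUs : (p.bind q).support ⊆ U := by
    intro b hb
    rw [PMF.support_bind] at hb
    simpa [hU] using hb
  rw [expect_eq_sum hUs, expect_eq_sum hS]
  have key : ∀ b, ((p.bind q) b).toReal = ∑ a ∈ hp.toFinset, (p a).toReal * (q a b).toReal := by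
    intro b
    rw [PMF.bind_apply, tsum_eq_sum (s := hp.toFinset), ENNReal.toReal_sum]
    · simp
    · exact fun a _ => ENNReal.mul_ne_top (p.apply_ne_top a) ((q a).apply_ne_top b)
    · intro a ha
      have : p a = 0 := by simpa using ha
      simp [this]
  simp only [key, Finset.sum_mul]
  rw [Finset.sum_comm]
  refine Finset.sum_congr rfl fun a ha => ?_
  rw [expect_eq_sum (S := U) (p := q a), Finset.mul_sum]
  · exact Finset.sum_congr rfl fun b _ => by ring
  · intro b hb
    simp only [hU, Finset.coe_biUnion, Set.mem_iUnion, Finset.mem_coe]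
    exact ⟨a, ha, by simpa using hb⟩

theorem expect_coin (p : ℝ) (h0 : 0 ≤ p) (h1 : p ≤ 1) (g : Bool → ℝ) :
    expect (coin p h0 h1) g = p * g true + (1 - p) * g false := by
  rw [expect_fintype]
  simp [coin, PMF.ofFintype_apply, ENNReal.toReal_ofReal h0,
    ENNReal.toReal_ofReal (sub_nonneg.2 h1)]

end Expect

/-! ### One-step recursions, history marginals and unbiasedness. -/

section MetaLearner

variable {X : Type u} {A : ℕ}

theorem BaseAlgorithm.finite_support (a : BaseAlgorithm X) (h : History X) :
    (a.propose h).support.Finite :=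
  a.policies.finite_toSet.subset fun x hx => a.propose_mem h x hx

theorem finite_support_sparseHistoryLaw (a : BaseAlgorithm X) (f : ℕ → X → ℝ)
    (ρ : ℝ) (h0 : 0 ≤ ρ) (h1 : ρ ≤ 1) (t : ℕ) :
    (sparseHistoryLaw a f ρ h0 h1 t).support.Finite := by
  induction t with
  | zero => exact finite_support_pure _
  | succ t ih =>
    exact finite_support_bind ih fun h => finite_support_bind (a.finite_support h) fun x =>
      finite_support_bind (Set.toFinite _) fun ξ => finite_support_pure _

theorem expect_sparseHistoryLaw_succ (a : BaseAlgorithm X) (f : ℕ → X → ℝ)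
    (ρ : ℝ) (h0 : 0 ≤ ρ) (h1 : ρ ≤ 1) (t : ℕ) (g : History X → ℝ) :
    expect (sparseHistoryLaw a f ρ h0 h1 (t + 1)) g =
      expect (sparseHistoryLaw a f ρ h0 h1 t) fun h =>
        ρ * expect (a.propose h) (fun x => g (h ++ [(x, f t x)])) + (1 - ρ) * g h := by
  rw [sparseHistoryLaw, expect_bind _ _ (finite_support_sparseHistoryLaw ..)]
  · congr 1
    funext h
    rw [expect_bind _ _ (a.finite_support h)]
    · simp_rw [expect_bind _ _ (Set.toFinite _) fun _ => finite_support_pure _, expect_pure,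
        expect_coin]
      simp only [if_true, Bool.false_eq_true, if_false]
      rw [expect_add _ (a.finite_support h), expect_const_mul, expect_const _ (a.finite_support h)]
    · exact fun x => finite_support_bind (Set.toFinite _) fun ξ => finite_support_pure _
  · exact fun h => finite_support_bind (a.finite_support h) fun x =>
      finite_support_bind (Set.toFinite _) fun ξ => finite_support_pure _

theorem log_next_w (η : Set.Ioc (0 : ℝ) 1) (s : State X A) (i j : Fin A) (x : X) (r : ℝ) (ξ : Bool) :
    Real.log ((s.next η i x r ξ).w j) =
      Real.log (s.w j) + (η : ℝ) / A * feedback η s i r j := by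
  change Real.log (s.w j * Real.exp _) = _
  rw [Real.log_mul (s.w_pos j).ne' (Real.exp_pos _).ne', Real.log_exp]
  ring

variable [NeZero A] (alg : Fin A → BaseAlgorithm X) (f : ℕ → X → ℝ) (η : Set.Ioc (0 : ℝ) 1)

theorem finite_support_stateLaw (t : ℕ) : (stateLaw alg f η t).support.Finite := by
  induction t with
  | zero => exact finite_support_pure _
  | succ t ih =>
    exact finite_support_bind ih fun s => finite_support_bind (Set.toFinite _) fun i =>
      finite_support_bind ((alg i).finite_support _) fun x =>
      finite_support_bind (Set.toFinite _) fun ξ => finite_support_pure _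

theorem expect_selLaw (s : State X A) (g : Fin A → ℝ) :
    expect (selLaw η s) g = ∑ i, selProb η s i * g i := by
  rw [expect_fintype]
  refine Finset.sum_congr rfl fun i _ => ?_
  rw [selLaw, PMF.ofFintype_apply, ENNReal.toReal_ofReal (selProb_pos η s i).le]

theorem expect_stateLaw_succ (t : ℕ) (g : State X A → ℝ) :
    expect (stateLaw alg f η (t + 1)) g =
      expect (stateLaw alg f η t) fun s =>
        ∑ i, selProb η s i * expect ((alg i).propose (s.hist i)) fun x =>
          keepProb η s i * g (s.next η i x (f t x) true) +
            (1 - keepProb η s i) * g (s.next η i x (f t x) false) := by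
  have h1 : ∀ (s : State X A) (i : Fin A) (x : X),
      ((coin (keepProb η s i) (keepProb_nonneg η s i) (keepProb_le_one η s i)).bind fun ξ =>
        PMF.pure (s.next η i x (f t x) ξ)).support.Finite := fun s i x =>
    finite_support_bind (Set.toFinite _) fun ξ => finite_support_pure _
  rw [stateLaw, expect_bind _ _ (finite_support_stateLaw ..)]
  · congr 1
    funext s
    rw [expect_bind _ _ (Set.toFinite _), expect_selLaw]
    · refine Finset.sum_congr rfl fun i _ => ?_
      rw [expect_bind _ _ ((alg i).finite_support _) (h1 s i)]
      simp_rw [expect_bind _ _ (Set.toFinite _) fun _ => finite_support_pure _, expect_pure,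
        expect_coin]
    · exact fun i => finite_support_bind ((alg i).finite_support _) (h1 s i)
  · exact fun s => finite_support_bind (Set.toFinite _) fun i =>
      finite_support_bind ((alg i).finite_support _) (h1 s i)

theorem expect_deployedLaw (t : ℕ) (g : X → ℝ) :
    expect (deployedLaw alg f η t) g =
      expect (stateLaw alg f η t) fun s =>
        ∑ i, selProb η s i * expect ((alg i).propose (s.hist i)) g := by
  rw [deployedLaw, expect_bind _ _ (finite_support_stateLaw ..)]
  · congr 1
    funext s
    rw [expect_bind _ _ (Set.toFinite _) fun i => (alg i).finite_support _, expect_selLaw]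
  · exact fun s => finite_support_bind (Set.toFinite _) fun i => (alg i).finite_support _

theorem selProb_mul_keepProb (s : State X A) (i : Fin A) :
    selProb η s i * keepProb η s i = η / A := by
  have := (selProb_pos η s i).ne'
  have hA : (A : ℝ) ≠ 0 := by exact_mod_cast NeZero.ne A
  unfold keepProb
  field_simp

/-- Under the meta-learner, the history of each base algorithm is distributed as a history fed
at the constant rate `η / A`. -/
theorem expect_stateLaw_hist (j : Fin A) (t : ℕ) (g : History X → ℝ) :
    expect (stateLaw alg f η t) (fun s => g (s.hist j)) =
      expect (sparseHistoryLaw (alg j) f ((η : ℝ) / A) (eta_div_nonneg η A)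
        (eta_div_le_one η A) t) g := by
  induction t generalizing g with
  | zero => rw [stateLaw, sparseHistoryLaw, expect_pure, expect_pure]; rfl
  | succ t ih =>
    rw [expect_stateLaw_succ, expect_sparseHistoryLaw_succ, ← ih]
    congr 1
    funext s
    -- Selecting `i ≠ j` leaves the history of `j` alone; for `i = j` the product of the selection
    -- and keep probabilities is `η / A`, whatever the weights.
    have hstep : ∀ i, selProb η s i * expect ((alg i).propose (s.hist i)) (fun x =>
          keepProb η s i * g ((s.next η i x (f t x) true).hist j) +
            (1 - keepProb η s i) * g ((s.next η i x (f t x) false).hist j)) =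
        selProb η s i * g (s.hist j) + if i = j then (η : ℝ) / A *
          (expect ((alg j).propose (s.hist j)) (fun x => g (s.hist j ++ [(x, f t x)]))
            - g (s.hist j)) else 0 := by
      intro i
      have hfin := (alg i).finite_support (s.hist i)
      by_cases hij : i = j
      · subst hij
        simp only [State.next, if_true, Bool.false_eq_true, if_false, Function.update_self]
        rw [expect_add _ hfin, expect_const_mul, expect_const _ hfin,
          ← selProb_mul_keepProb η s i]
        ring
      · simp only [State.next, if_true, Bool.false_eq_true, if_false,
          Function.update_of_ne (Ne.symm hij), if_neg hij]
        rw [expect_const _ hfin]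
        ring
    rw [Finset.sum_congr rfl fun i _ => hstep i, Finset.sum_add_distrib, ← Finset.sum_mul,
      sum_selProb]
    simp only [Finset.sum_ite_eq', Finset.mem_univ, if_true]
    ring

theorem algReward_eq_sum (T : ℕ) (j : Fin A) :
    algReward alg f η T j = ∑ t ∈ Finset.range T,
      expect (stateLaw alg f η t) fun s => expect ((alg j).propose (s.hist j)) (f t) := by
  unfold algReward sparseReward
  refine Finset.sum_congr rfl fun t _ => ?_
  rw [expect_bind _ _ (finite_support_sparseHistoryLaw ..) fun h => (alg j).finite_support h,
    expect_stateLaw_hist alg f η j t fun h => expect ((alg j).propose h) (f t)]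

/-- The log-weight is `η / A` times the sum of the importance-weighted feedbacks, whose selection
probability cancels in expectation. -/
theorem expect_log_w (j : Fin A) (T : ℕ) :
    expect (stateLaw alg f η T) (fun s => Real.log (s.w j)) =
      (η : ℝ) / A * algReward alg f η T j := by
  rw [algReward_eq_sum]
  induction T with
  | zero => simp [stateLaw, expect_pure, State.init]
  | succ t ih =>
    rw [Finset.sum_range_succ, mul_add, ← ih, ← expect_const_mul,
      ← expect_add _ (finite_support_stateLaw ..), expect_stateLaw_succ]
    congr 1
    funext s
    have hstep : ∀ i, selProb η s i * expect ((alg i).propose (s.hist i)) (fun x =>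
          keepProb η s i * Real.log ((s.next η i x (f t x) true).w j) +
            (1 - keepProb η s i) * Real.log ((s.next η i x (f t x) false).w j)) =
        selProb η s i * Real.log (s.w j) + if i = j then (η : ℝ) / A *
          expect ((alg j).propose (s.hist j)) (f t) else 0 := by
      intro i
      have hfin := (alg i).finite_support (s.hist i)
      have hy := (selProb_pos η s i).ne'
      simp only [log_next_w]
      -- The weight update ignores the feedback bit, so the coin averages out.
      have : ∀ a b : ℝ, keepProb η s i * (a + b) + (1 - keepProb η s i) * (a + b) = a + b :=
        fun a b => by ring
      simp only [this]
      rw [expect_add _ hfin, expect_const _ hfin, expect_const_mul, mul_add]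
      congr 1
      by_cases hij : i = j
      · subst hij
        simp only [feedback, if_true, div_eq_inv_mul (f t _), expect_const_mul]
        field_simp
      · simp only [feedback, if_neg hij, if_neg (Ne.symm hij), expect_const _ hfin]
        ring
    rw [Finset.sum_congr rfl fun i _ => hstep i, Finset.sum_add_distrib, ← Finset.sum_mul,
      sum_selProb]
    simp

end MetaLearner

/-! ### The Exp3 potential argument. -/

section Potential

variable {X : Type u} {A : ℕ}

theorem sum_next_w (η : Set.Ioc (0 : ℝ) 1) (s : State X A) (i : Fin A) (x : X) (r : ℝ) (ξ : Bool) :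
    ∑ j, (s.next η i x r ξ).w j =
      ∑ j, s.w j + s.w i * (Real.exp ((η : ℝ) / A * (r / selProb η s i)) - 1) := by
  have h : ∀ j, (s.next η i x r ξ).w j = s.w j + if j = i then
      s.w i * (Real.exp ((η : ℝ) / A * (r / selProb η s i)) - 1) else 0 := by
    intro j
    change s.w j * Real.exp ((η : ℝ) * feedback η s i r j / A) = _
    by_cases hj : j = i
    · subst hj
      simp only [feedback, if_true]
      rw [mul_div_right_comm]
      ring
    · simp [feedback, hj]
  simp [Finset.sum_congr rfl fun j _ => h j, Finset.sum_add_distrib]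

theorem expect_mem_Icc {p : PMF X} (hp : p.support.Finite) {g : X → ℝ}
    (hg : ∀ x, g x ∈ Set.Icc (0 : ℝ) 1) : expect p g ∈ Set.Icc (0 : ℝ) 1 :=
  ⟨(expect_const p hp 0).symm.trans_le (expect_mono p hp fun x => (hg x).1),
    (expect_mono p hp fun x => (hg x).2).trans_eq (expect_const p hp 1)⟩

theorem algReward_le (alg : Fin A → BaseAlgorithm X) {f : ℕ → X → ℝ} (η : Set.Ioc (0 : ℝ) 1)
    (hf : ∀ t x, f t x ∈ Set.Icc (0 : ℝ) 1) (T : ℕ) (j : Fin A) :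
    algReward alg f η T j ≤ T := by
  unfold algReward sparseReward
  refine (Finset.sum_le_card_nsmul _ _ 1 fun t _ => (expect_mem_Icc (finite_support_bind
    (finite_support_sparseHistoryLaw ..) fun h => (alg j).finite_support h) (hf t)).2).trans_eq ?_
  simp

theorem bestPolicyReward_le (a : BaseAlgorithm X) {f : ℕ → X → ℝ}
    (hf : ∀ t x, f t x ∈ Set.Icc (0 : ℝ) 1) (T : ℕ) : bestPolicyReward a f T ≤ T := by
  refine Finset.sup'_le _ _ fun x _ => ?_
  refine (Finset.sum_le_card_nsmul _ _ 1 fun t _ => (hf t x).2).trans_eq ?_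
  simp

variable [NeZero A]

theorem sum_w_pos (s : State X A) : 0 < ∑ j, s.w j :=
  Finset.sum_pos (fun k _ => s.w_pos k) Finset.univ_nonempty

/-- This combines `log z ≤ z - 1` with `exp v ≤ 1 + v + v²`. The factor `1 - η` turns the normalized
weight into a quantity below the selection probability, and avoids dividing by `1 - η`, which may
vanish. -/
theorem log_sum_next_w_le (η : Set.Ioc (0 : ℝ) 1) (s : State X A) (i : Fin A) (x : X)
    {r : ℝ} (hr : r ∈ Set.Icc (0 : ℝ) 1) (ξ : Bool) :
    (1 - (η : ℝ)) * Real.log (∑ j, (s.next η i x r ξ).w j) ≤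
      (1 - (η : ℝ)) * Real.log (∑ j, s.w j) +
        ((η : ℝ) / A * r + ((η : ℝ) / A) ^ 2 * (r / selProb η s i)) := by
  obtain ⟨hr0, hr1⟩ := hr
  have hW := sum_w_pos s
  have hW' := sum_w_pos (s.next η i x r ξ)
  have hy := selProb_pos η s i
  have hρ := eta_div_pos η i
  have hρy := eta_div_le_selProb η s i
  set W := ∑ j, s.w j with hWdef
  set W' := ∑ j, (s.next η i x r ξ).w j with hW'def
  set y := selProb η s i with hydef
  set ρ := (η : ℝ) / A with hρdef
  set v := ρ * (r / y) with hv
  have hv0 : 0 ≤ v := by positivity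
  -- Forced exploration gives `ρ ≤ y`, which keeps the exponent in the range of the quadratic bound.
  have hv1 : v ≤ 1 := by
    rw [hv, ← mul_div_assoc, div_le_one hy]
    nlinarith
  have hexp : Real.exp v - 1 ≤ v + v ^ 2 := by
    have := (abs_le.1 (Real.abs_exp_sub_one_sub_id_le (abs_le.2 ⟨by linarith, hv1⟩))).2
    linarith
  have hlog : Real.log W' - Real.log W ≤ s.w i / W * (v + v ^ 2) := by
    rw [← Real.log_div hW'.ne' hW.ne']
    refine (Real.log_le_sub_one_of_pos (div_pos hW' hW)).trans ?_
    have : W' / W - 1 = s.w i / W * (Real.exp v - 1) := by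
      have hs : W' = W + s.w i * (Real.exp v - 1) := sum_next_w η s i x r ξ
      rw [hs]
      field_simp
      ring
    rw [this]
    exact mul_le_mul_of_nonneg_left hexp (div_pos (s.w_pos i) hW).le
  have hη : 0 ≤ 1 - (η : ℝ) := sub_nonneg.2 η.2.2
  have hp : (1 - (η : ℝ)) * (s.w i / W) ≤ y := by
    rw [hydef, selProb]
    linarith
  have h1 : (1 - (η : ℝ)) * (Real.log W' - Real.log W) ≤ y * (v + v ^ 2) :=
    calc _ ≤ (1 - (η : ℝ)) * (s.w i / W * (v + v ^ 2)) := mul_le_mul_of_nonneg_left hlog hη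
      _ = (1 - (η : ℝ)) * (s.w i / W) * (v + v ^ 2) := by ring
      _ ≤ _ := mul_le_mul_of_nonneg_right hp (by positivity)
  have h2 : y * (v + v ^ 2) = ρ * r + ρ ^ 2 * (r * r / y) := by
    rw [hv]
    field_simp
  have h3 : ρ ^ 2 * (r * r / y) ≤ ρ ^ 2 * (r / y) := by
    gcongr
    nlinarith
  linarith

variable (alg : Fin A → BaseAlgorithm X) (f : ℕ → X → ℝ) (η : Set.Ioc (0 : ℝ) 1)

theorem expect_log_sum_w_succ_le (hf : ∀ t x, f t x ∈ Set.Icc (0 : ℝ) 1) (t : ℕ) :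
    (1 - (η : ℝ)) * expect (stateLaw alg f η (t + 1)) (fun s => Real.log (∑ j, s.w j)) ≤
      (1 - (η : ℝ)) * expect (stateLaw alg f η t) (fun s => Real.log (∑ j, s.w j)) +
        ((η : ℝ) / A * expect (deployedLaw alg f η t) (f t) + ((η : ℝ) / A) ^ 2 * A) := by
  have hfin := finite_support_stateLaw alg f η t
  rw [expect_deployedLaw, ← expect_const_mul, ← expect_const_mul, ← expect_const_mul,
    ← expect_const _ hfin (((η : ℝ) / A) ^ 2 * A), ← expect_add _ hfin, ← expect_add _ hfin,
    expect_stateLaw_succ]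
  refine expect_mono _ hfin fun s => ?_
  have hstep : ∀ i ∈ Finset.univ, selProb η s i * expect ((alg i).propose (s.hist i)) (fun x =>
        keepProb η s i * ((1 - (η : ℝ)) * Real.log (∑ j, (s.next η i x (f t x) true).w j)) +
        (1 - keepProb η s i) *
          ((1 - (η : ℝ)) * Real.log (∑ j, (s.next η i x (f t x) false).w j))) ≤
      selProb η s i * ((1 - (η : ℝ)) * Real.log (∑ j, s.w j)) +
        ((η : ℝ) / A * (selProb η s i * expect ((alg i).propose (s.hist i)) (f t)) +
          ((η : ℝ) / A) ^ 2) := by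
    intro i _
    have hfin := (alg i).finite_support (s.hist i)
    have hy := selProb_pos η s i
    have hk0 := keepProb_nonneg η s i
    have hk1 := sub_nonneg.2 (keepProb_le_one η s i)
    have hle := expect_mono ((alg i).propose (s.hist i)) hfin fun x => by
      have h1 := mul_le_mul_of_nonneg_left (log_sum_next_w_le η s i x (hf t x) true) hk0
      have h2 := mul_le_mul_of_nonneg_left (log_sum_next_w_le η s i x (hf t x) false) hk1
      exact (add_le_add h1 h2).trans_eq
        (by ring : _ = (1 - (η : ℝ)) * Real.log (∑ j, s.w j) +
          ((η : ℝ) / A + ((η : ℝ) / A) ^ 2 / selProb η s i) * f t x)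
    refine (mul_le_mul_of_nonneg_left hle hy.le).trans ?_
    rw [expect_add _ hfin, expect_const _ hfin, expect_const_mul]
    have he1 : expect ((alg i).propose (s.hist i)) (f t) ≤ 1 :=
      (expect_mono _ hfin fun x => (hf t x).2).trans_eq (expect_const _ hfin 1)
    -- Averaging over the selection cancels `1 / y` in the second-order term: each algorithm costs
    -- at most `(η / A)²`.
    have h4 : selProb η s i * (((η : ℝ) / A + ((η : ℝ) / A) ^ 2 / selProb η s i) *
        expect ((alg i).propose (s.hist i)) (f t)) =
        (η : ℝ) / A * (selProb η s i * expect ((alg i).propose (s.hist i)) (f t)) +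
          ((η : ℝ) / A) ^ 2 * expect ((alg i).propose (s.hist i)) (f t) := by
      generalize (η : ℝ) / A = ρ
      field_simp
    rw [mul_add, h4]
    have := mul_le_mul_of_nonneg_left he1 (sq_nonneg ((η : ℝ) / A))
    linarith
  refine (Finset.sum_le_sum hstep).trans_eq ?_
  rw [Finset.sum_add_distrib, Finset.sum_add_distrib, ← Finset.sum_mul, sum_selProb,
    ← Finset.mul_sum]
  simp
  ring

theorem expect_log_sum_w_le (hf : ∀ t x, f t x ∈ Set.Icc (0 : ℝ) 1) (T : ℕ) :
    (1 - (η : ℝ)) * expect (stateLaw alg f η T) (fun s => Real.log (∑ j, s.w j)) ≤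
      (1 - (η : ℝ)) * Real.log A +
        ((η : ℝ) / A * metaReward alg f η T + ((η : ℝ) / A) ^ 2 * A * T) := by
  unfold metaReward
  induction T with
  | zero => simp [stateLaw, expect_pure, State.init]
  | succ t ih =>
    have := expect_log_sum_w_succ_le alg f η hf t
    rw [Finset.sum_range_succ]
    push_cast
    linarith

theorem metaReward_nonneg (hf : ∀ t x, f t x ∈ Set.Icc (0 : ℝ) 1) (T : ℕ) :
    0 ≤ metaReward alg f η T :=
  Finset.sum_nonneg fun t _ => (expect_mem_Icc (finite_support_bind
    (finite_support_stateLaw alg f η t) fun _ => finite_support_bind (Set.toFinite _) fun i =>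
      (alg i).finite_support _) (hf t)).1

/-- Exp3 regret bound of the meta-learner against a single base algorithm. -/
theorem algReward_sub_metaReward_le (hf : ∀ t x, f t x ∈ Set.Icc (0 : ℝ) 1) (T : ℕ)
    (j : Fin A) :
    algReward alg f η T j - metaReward alg f η T ≤
      2 * (η * T) + A / (η : ℝ) * Real.log A := by
  have hA : (1 : ℝ) ≤ A := by exact_mod_cast j.pos
  have hη0 : 0 < (η : ℝ) := η.2.1
  have hη1 : 0 ≤ 1 - (η : ℝ) := sub_nonneg.2 η.2.2
  have hlow : (η : ℝ) / A * algReward alg f η T j ≤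
      expect (stateLaw alg f η T) (fun s => Real.log (∑ j, s.w j)) := by
    rw [← expect_log_w]
    exact expect_mono _ (finite_support_stateLaw ..) fun s => Real.log_le_log (s.w_pos j)
      (Finset.single_le_sum (fun k _ => (s.w_pos k).le) (Finset.mem_univ j))
  have h := (mul_le_mul_of_nonneg_left hlow hη1).trans (expect_log_sum_w_le alg f η hf T)
  have hG := algReward_le alg η hf T j
  have hl := Real.log_nonneg hA
  generalize algReward alg f η T j = G at *
  generalize metaReward alg f η T = M at *
  have h' := mul_le_mul_of_nonneg_left h (by positivity : 0 ≤ A / (η : ℝ))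
  have e1 : A / (η : ℝ) * ((1 - (η : ℝ)) * ((η : ℝ) / A * G)) = (1 - (η : ℝ)) * G := by
    field_simp
  have e2 : A / (η : ℝ) * ((1 - (η : ℝ)) * Real.log A +
      ((η : ℝ) / A * M + ((η : ℝ) / A) ^ 2 * A * T)) =
      A / (η : ℝ) * Real.log A - A * Real.log A + M + η * T := by
    field_simp
    ring
  rw [e1, e2] at h'
  -- One `η T` is the second-order cost; the other bounds `η G`, the price of the factor `1 - η`.
  nlinarith [mul_nonneg (by linarith : (0 : ℝ) ≤ A) hl, mul_le_mul_of_nonneg_left hG hη0.le]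

end Potential

/-! ### Tuning of the rates. -/

theorem rpow_le_one_add_rpow {x a b : ℝ} (hx : 0 ≤ x) (ha : 0 ≤ a) (hab : a ≤ b) :
    x ^ a ≤ 1 + x ^ b := by
  rcases le_total x 1 with h | h
  · linarith [Real.rpow_le_one hx h ha, Real.rpow_nonneg hx b]
  · linarith [Real.rpow_le_rpow_of_exponent_le h hab]

theorem logFactor_of_ne_zero {β : ℝ} (hβ : β ≠ 0) (A : ℕ) : logFactor β A = 1 := by
  simp [logFactor, hβ]

theorem logFactor_zero (A : ℕ) : logFactor 0 A = √(Real.log A) := by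
  simp [logFactor, Real.sqrt_eq_rpow]

theorem logFactor_nonneg (β : ℝ) (A : ℕ) : 0 ≤ logFactor β A :=
  Real.rpow_nonneg (Real.log_natCast_nonneg A) _

section Rates

variable {β : ℝ} {T A : ℕ} {c η : ℝ}

theorem mul_le_regretRate_of_le_etaRate (hβ0 : 0 ≤ β) (hβ1 : β ≤ 1) (hT : 0 < T) (hA : 0 < A)
    (hc : 0 < c) (hη : η ≤ c * etaRate β T A) : η * T ≤ c * regretRate β T A := by
  have hT0 : (0 : ℝ) < T := by exact_mod_cast hT
  have hA1 : (1 : ℝ) ≤ A := by exact_mod_cast hA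
  have h2 : 0 < 2 - β := by linarith
  calc η * T ≤ c * etaRate β T A * T := by gcongr
    _ = c * ((T : ℝ) ^ (-((1 - β) / (2 - β))) * (T : ℝ) ^ (1 : ℝ) *
          (A : ℝ) ^ ((1 - β) / (2 - β)) * logFactor β A) := by
        rw [etaRate, Real.rpow_one]; ring
    _ = c * ((T : ℝ) ^ (1 / (2 - β)) * (A : ℝ) ^ ((1 - β) / (2 - β)) * logFactor β A) := by
        rw [← Real.rpow_add hT0]
        congr 4
        field_simp
        ring
    _ ≤ c * regretRate β T A := by
        have := logFactor_nonneg β A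
        unfold regretRate
        gcongr
        linarith

/-- The exponents `1/(2-β)` and `(1-β)/(2-β)` of `A` add up to `1`. The log factor stays on the left
because it vanishes for `β = 0`, `A = 1`. -/
theorem div_mul_logFactor_le (hβ1 : β ≤ 1) (hT : 0 < T) (hA : 0 < A)
    (hc : 0 < c) (hη0 : 0 < η) (hη : c * etaRate β T A ≤ η) :
    A / η * logFactor β A ≤
      c⁻¹ * ((A : ℝ) ^ (1 / (2 - β)) * (T : ℝ) ^ ((1 - β) / (2 - β))) := by
  have hT0 : (0 : ℝ) < T := by exact_mod_cast hT
  have hA0 : (0 : ℝ) < A := by exact_mod_cast hA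
  have h2 : 2 - β ≠ 0 := by linarith
  have e1 : (A : ℝ) = (A : ℝ) ^ (1 / (2 - β)) * (A : ℝ) ^ ((1 - β) / (2 - β)) := by
    rw [← Real.rpow_add hA0]
    conv_lhs => rw [← Real.rpow_one (A : ℝ)]
    congr 1
    field_simp
    ring
  have e2 : (T : ℝ) ^ ((1 - β) / (2 - β)) * (T : ℝ) ^ (-((1 - β) / (2 - β))) = 1 := by
    rw [← Real.rpow_add hT0, add_neg_cancel, Real.rpow_zero]
  rw [div_mul_eq_mul_div, div_le_iff₀ hη0]
  calc (A : ℝ) * logFactor β A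
      = c⁻¹ * ((A : ℝ) ^ (1 / (2 - β)) * (T : ℝ) ^ ((1 - β) / (2 - β))) *
          (c * etaRate β T A) := by
        have : c⁻¹ * ((A : ℝ) ^ (1 / (2 - β)) * (T : ℝ) ^ ((1 - β) / (2 - β))) *
          (c * etaRate β T A) = (c⁻¹ * c) * ((T : ℝ) ^ ((1 - β) / (2 - β)) *
            (T : ℝ) ^ (-((1 - β) / (2 - β)))) * ((A : ℝ) ^ (1 / (2 - β)) *
            (A : ℝ) ^ ((1 - β) / (2 - β))) * logFactor β A := by
          rw [etaRate]; ring
        rw [this, e2, ← e1, inv_mul_cancel₀ hc.ne']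
        ring
    _ ≤ _ := by gcongr

/-- Use `log A ≤ A^ε / ε` with `ε = β/(2-β)`, exactly the gap between the exponents `(1-β)/(2-β)`
and `1/(2-β)` of `T`. -/
theorem log_le_of_etaRate_le (hβ0 : 0 < β) (hβ1 : β < 1) (hT : 0 < T) (hA : 0 < A)
    (hc : 0 < c) (h : c * etaRate β T A ≤ 1) :
    Real.log A ≤ (c⁻¹ ^ (β / (1 - β)) / (β / (2 - β))) * (T : ℝ) ^ (β / (2 - β)) := by
  have hT0 : (0 : ℝ) < T := by exact_mod_cast hT
  have hA0 : (0 : ℝ) < A := by exact_mod_cast hA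
  have h2 : 0 < 2 - β := by linarith
  have h1 : 0 < 1 - β := by linarith
  have hε : 0 < β / (2 - β) := by positivity
  have hAp : (A : ℝ) ^ ((1 - β) / (2 - β)) ≤ c⁻¹ * (T : ℝ) ^ ((1 - β) / (2 - β)) := by
    rw [etaRate, logFactor_of_ne_zero hβ0.ne', mul_one, Real.rpow_neg hT0.le] at h
    have hTp : 0 < (T : ℝ) ^ ((1 - β) / (2 - β)) := by positivity
    rw [← div_eq_inv_mul, le_div_iff₀ hc]
    rw [← div_eq_inv_mul, ← mul_div_assoc, div_le_one hTp] at h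
    linarith
  have hpow : (A : ℝ) ^ (β / (2 - β)) ≤ c⁻¹ ^ (β / (1 - β)) * (T : ℝ) ^ (β / (2 - β)) := by
    have := Real.rpow_le_rpow (by positivity) hAp (by positivity : 0 ≤ β / (1 - β))
    rw [Real.mul_rpow (by positivity) (by positivity), ← Real.rpow_mul hA0.le,
      ← Real.rpow_mul hT0.le] at this
    have e : (1 - β) / (2 - β) * (β / (1 - β)) = β / (2 - β) := by
      field_simp
    rwa [e] at this
  calc Real.log A ≤ (A : ℝ) ^ (β / (2 - β)) / (β / (2 - β)) := Real.log_le_rpow_div hA0.le hε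
    _ ≤ c⁻¹ ^ (β / (1 - β)) * (T : ℝ) ^ (β / (2 - β)) / (β / (2 - β)) := by gcongr
    _ = _ := by ring

/-- Tuning bound for a positive exponent. -/
theorem rate_terms_le_of_pos (hβ0 : 0 < β) (hβ1 : β < 1) (hT : 0 < T) (hA : 0 < A)
    (hc : 0 < c) (hη0 : 0 < η) (hη1 : η ≤ 1) (hη : c * etaRate β T A ≤ η) :
    A / η ≤ c⁻¹ * regretRate β T A ∧
    (η / A * T) ^ β * (A / η) ≤ c⁻¹ ^ (1 - β) * regretRate β T A ∧
    A / η * Real.log A ≤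
      c⁻¹ * (c⁻¹ ^ (β / (1 - β)) / (β / (2 - β))) * regretRate β T A := by
  have hT0 : (0 : ℝ) < T := by exact_mod_cast hT
  have hA0 : (0 : ℝ) < A := by exact_mod_cast hA
  have hT1 : (1 : ℝ) ≤ T := by exact_mod_cast hT
  have hA1 : (1 : ℝ) ≤ A := by exact_mod_cast hA
  have h2 : 0 < 2 - β := by linarith
  have h1 : 0 < 1 - β := by linarith
  have hD := div_mul_logFactor_le hβ1.le hT hA hc hη0 hη
  rw [logFactor_of_ne_zero hβ0.ne', mul_one] at hD
  have hD0 : 0 < A / η := by positivity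
  have hR : regretRate β T A = (T : ℝ) ^ (1 / (2 - β)) * (A : ℝ) ^ (1 / (2 - β)) := by
    rw [regretRate, logFactor_of_ne_zero hβ0.ne', mul_one]
  have hpq : (1 - β) / (2 - β) ≤ 1 / (2 - β) := by gcongr; linarith
  refine ⟨?_, ?_, ?_⟩
  · refine hD.trans ?_
    rw [hR, mul_comm ((T : ℝ) ^ _)]
    gcongr
  -- In this form only an upper bound on `A / η` is needed; the powers of `T` then match since `β +
  -- (1-β)²/(2-β) = 1/(2-β)`.
  · have e : (η / A * T) ^ β * (A / η) = (T : ℝ) ^ β * (A / η) ^ (1 - β) := by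
      have e0 : η / A = (A / η)⁻¹ := by rw [inv_div]
      rw [e0, Real.mul_rpow (by positivity) hT0.le, Real.inv_rpow hD0.le, sub_eq_add_neg,
        Real.rpow_add hD0, Real.rpow_one, Real.rpow_neg hD0.le]
      ring
    have hDp := Real.rpow_le_rpow hD0.le hD h1.le
    rw [Real.mul_rpow (by positivity) (by positivity),
      Real.mul_rpow (by positivity) (by positivity), ← Real.rpow_mul hA0.le,
      ← Real.rpow_mul hT0.le] at hDp
    calc (η / A * T) ^ β * (A / η) = (T : ℝ) ^ β * (A / η) ^ (1 - β) := e
      _ ≤ (T : ℝ) ^ β * (c⁻¹ ^ (1 - β) * ((A : ℝ) ^ (1 / (2 - β) * (1 - β)) *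
            (T : ℝ) ^ ((1 - β) / (2 - β) * (1 - β)))) := by gcongr
      _ = c⁻¹ ^ (1 - β) * (((T : ℝ) ^ β * (T : ℝ) ^ ((1 - β) / (2 - β) * (1 - β))) *
            (A : ℝ) ^ (1 / (2 - β) * (1 - β))) := by ring
      _ = c⁻¹ ^ (1 - β) * ((T : ℝ) ^ (1 / (2 - β)) * (A : ℝ) ^ ((1 - β) / (2 - β))) := by
          rw [← Real.rpow_add hT0]
          congr 3
          · field_simp
            ring
          · ring
      _ ≤ c⁻¹ ^ (1 - β) * regretRate β T A := by
          rw [hR]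
          gcongr
  · have hl := log_le_of_etaRate_le hβ0 hβ1 hT hA hc (hη.trans hη1)
    have hl0 := Real.log_nonneg hA1
    calc A / η * Real.log A
        ≤ (c⁻¹ * ((A : ℝ) ^ (1 / (2 - β)) * (T : ℝ) ^ ((1 - β) / (2 - β)))) *
          ((c⁻¹ ^ (β / (1 - β)) / (β / (2 - β))) * (T : ℝ) ^ (β / (2 - β))) := by gcongr
      _ = c⁻¹ * (c⁻¹ ^ (β / (1 - β)) / (β / (2 - β))) *
          (((T : ℝ) ^ ((1 - β) / (2 - β)) * (T : ℝ) ^ (β / (2 - β))) *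
            (A : ℝ) ^ (1 / (2 - β))) := by ring
      _ = _ := by
          rw [hR, ← Real.rpow_add hT0]
          congr 4
          field_simp
          ring

/-- Tuning bound for the exponent zero. -/
theorem rate_terms_le_zero (hT : 0 < T) (hA : 1 < A)
    (hc : 0 < c) (hη0 : 0 < η) (hη : c * etaRate 0 T A ≤ η) :
    A / η ≤ c⁻¹ / Real.log 2 * regretRate 0 T A ∧
    A / η * Real.log A ≤ c⁻¹ * regretRate 0 T A := by
  have hD := div_mul_logFactor_le zero_le_one hT (by omega) hc hη0 hη
  have hA2 : (2 : ℝ) ≤ A := by exact_mod_cast hA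
  have hlog2 : 0 < Real.log 2 := Real.log_pos one_lt_two
  have hlog : Real.log 2 ≤ Real.log A := Real.log_le_log two_pos hA2
  have hsq : logFactor 0 A * logFactor 0 A = Real.log A := by
    rw [logFactor_zero, Real.mul_self_sqrt (hlog2.le.trans hlog)]
  have hlast : A / η * Real.log A ≤ c⁻¹ * regretRate 0 T A := by
    have := mul_le_mul_of_nonneg_right hD (logFactor_nonneg 0 A)
    rw [mul_assoc, hsq] at this
    refine this.trans_eq ?_
    rw [regretRate, sub_zero, sub_zero]
    ring
  refine ⟨?_, hlast⟩
  -- As `A ≥ 2`, the bare `A / η` costs only `1 / log 2` more than the logarithmic term.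
  rw [div_mul_eq_mul_div, le_div_iff₀ hlog2]
  exact (mul_le_mul_of_nonneg_left hlog (by positivity)).trans hlast

/-- For `A = 1` the factor `√(log A)` vanishes, which would force `η ≤ 0`. -/
theorem one_lt_of_le_etaRate_zero (hA : 0 < A) (hη0 : 0 < η) (hη : η ≤ c * etaRate 0 T A) :
    1 < A := by
  by_contra h
  have : A = 1 := by omega
  subst this
  simp [etaRate, logFactor_zero] at hη
  linarith

theorem exists_rate_constant (hβ0 : 0 ≤ β) (hβ1 : β < 1) (c₁ c₂ : ℝ) (hc₁ : 0 < c₁) :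
    ∃ B : ℝ, 0 < B ∧ ∀ T : ℕ, 0 < T → ∀ A : ℕ, 0 < A → ∀ η : ℝ, 0 < η → η ≤ 1 →
      c₁ * etaRate β T A ≤ η → η ≤ c₂ * etaRate β T A →
      A / η ≤ B * regretRate β T A ∧
      (η / A * T) ^ β * (A / η) ≤ B * regretRate β T A ∧
      A / η * Real.log A ≤ B * regretRate β T A := by
  have hlog2 : 0 < Real.log 2 := Real.log_pos one_lt_two
  have hR : ∀ T A : ℕ, 0 ≤ regretRate β T A := fun T A => by
    have := logFactor_nonneg β A
    unfold regretRate
    positivity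
  rcases hβ0.eq_or_lt with rfl | hβ0
  · refine ⟨c₁⁻¹ / Real.log 2 + c₁⁻¹, by positivity, fun T hT A hA η hη0 hη1 h1 h2 => ?_⟩
    obtain ⟨ha, hb⟩ := rate_terms_le_zero hT (one_lt_of_le_etaRate_zero hA hη0 h2) hc₁ hη0 h1
    have p1 := mul_nonneg (by positivity : 0 ≤ c₁⁻¹ / Real.log 2) (hR T A)
    have p2 := mul_nonneg (by positivity : 0 ≤ c₁⁻¹) (hR T A)
    rw [Real.rpow_zero, one_mul, add_mul]
    exact ⟨by linarith, by linarith, by linarith⟩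
  · have h1 : 0 < 1 - β := by linarith
    have h2 : 0 < 2 - β := by linarith
    refine ⟨c₁⁻¹ + c₁⁻¹ ^ (1 - β) + c₁⁻¹ * (c₁⁻¹ ^ (β / (1 - β)) / (β / (2 - β))),
      by positivity, fun T hT A hA η hη0 hη1 hle _ => ?_⟩
    obtain ⟨ha, hb, hd⟩ := rate_terms_le_of_pos hβ0 hβ1 hT hA hc₁ hη0 hη1 hle
    have p1 := mul_nonneg (by positivity : 0 ≤ c₁⁻¹) (hR T A)
    have p2 := mul_nonneg (by positivity : 0 ≤ c₁⁻¹ ^ (1 - β)) (hR T A)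
    have p3 := mul_nonneg
      (by positivity : 0 ≤ c₁⁻¹ * (c₁⁻¹ ^ (β / (1 - β)) / (β / (2 - β)))) (hR T A)
    rw [add_mul, add_mul]
    exact ⟨by linarith, by linarith, by linarith⟩

theorem regretRate_isLittleO (hβ1 : β < 1) (A : ℕ) :
    (fun T : ℕ => regretRate β T A) =o[atTop] (fun T : ℕ => (T : ℝ)) := by
  have hq : 1 / (2 - β) < 1 := by
    rw [div_lt_one (by linarith)]
    linarith
  have h : (fun T : ℕ => (T : ℝ) ^ (1 / (2 - β))) =o[atTop] (fun T : ℕ => (T : ℝ)) := by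
    refine (isLittleO_iff_tendsto' ?_).2 ?_
    · filter_upwards [eventually_gt_atTop 0] with T hT h0
      exact absurd h0 (by positivity)
    · refine ((tendsto_rpow_neg_atTop (sub_pos.2 hq)).comp tendsto_natCast_atTop_atTop).congr' ?_
      filter_upwards [eventually_gt_atTop 0] with T hT
      have hT0 : (0 : ℝ) < T := by exact_mod_cast hT
      rw [Function.comp_apply, neg_sub, Real.rpow_sub_one hT0.ne']
  simpa only [regretRate, mul_assoc, mul_comm] using
    h.const_mul_left ((A : ℝ) ^ (1 / (2 - β)) * logFactor β A)

end Rates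

end MetBS

/-! ### Assembling the regret bound. -/

theorem lemma2
    -- the exponent used for tuning, the constants of the `Θ` for `η`, and the constant of
    -- the `O` in the regret assumption on the best algorithm
    (β : ℝ) (hβ0 : 0 ≤ β) (hβ1 : β ≤ 1)
    (c₁ c₂ K : ℝ) (hc₁ : 0 < c₁) (hc₂ : 0 < c₂) (hK : 0 < K) :
    (∃ C : ℝ, 0 < C ∧
      ∀ (T : ℕ), 0 < T → ∀ (A : ℕ) [NeZero A] (X : Type*)
        (alg : Fin A → BaseAlgorithm X)
        (f : ℕ → X → ℝ), (∀ t x, f t x ∈ Set.Icc (0 : ℝ) 1) →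
      ∀ η : Set.Ioc (0 : ℝ) 1,
        c₁ * etaRate β T A ≤ (η : ℝ) → (η : ℝ) ≤ c₂ * etaRate β T A →
      ∀ i : Fin A, IsBestAlgorithm alg f η T i →
      ∀ βi : ℝ, 0 ≤ βi → βi ≤ β →
        algRegret alg f η T i ≤ K * (((η : ℝ) / A * T) ^ βi / ((η : ℝ) / A)) →
        metaRegret alg f η T i ≤ C * regretRate β T A) ∧
    (β < 1 → ∀ A : ℕ,
      (fun T : ℕ => regretRate β T A) =o[Filter.atTop] (fun T : ℕ => (T : ℝ))) := by
  refine ⟨?_, fun h A => regretRate_isLittleO h A⟩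
  rcases hβ1.eq_or_lt with rfl | hβ1'
  -- At `β = 1` the claimed rate is `T A`, while the regret never exceeds `T`.
  · refine ⟨1, one_pos, fun T hT A _ X alg f hf η _ _ i _ βi _ _ _ => ?_⟩
    have hA1 : (1 : ℝ) ≤ A := by exact_mod_cast i.pos
    have hM := metaReward_nonneg alg f η hf T
    have hB := bestPolicyReward_le (alg i) hf T
    have hR : regretRate 1 T A = T * A := by
      rw [regretRate, logFactor_of_ne_zero one_ne_zero]
      norm_num
    rw [metaRegret, hR]
    nlinarith [(Nat.cast_nonneg T : (0 : ℝ) ≤ T)]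
  · obtain ⟨B, hB, hrate⟩ := exists_rate_constant hβ0 hβ1' c₁ c₂ hc₁
    -- The summands pay for the regret of `i`, for `2ηT` and for `(A/η) log A`.
    refine ⟨2 * K * B + 2 * c₂ + B, by positivity,
      fun T hT A _ X alg f hf η h1 h2 i _ βi hβi0 hβi hreg => ?_⟩
    have hA0 : (0 : ℝ) < A := by exact_mod_cast i.pos
    have hη0 : 0 < (η : ℝ) := η.2.1
    obtain ⟨ha, hb, hd⟩ := hrate T hT A i.pos η hη0 η.2.2 h1 h2
    have he := mul_le_regretRate_of_le_etaRate hβ0 hβ1 hT i.pos hc₂ h2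
    have hexp3 := algReward_sub_metaReward_le alg f η hf T i
    have hpow : ((η : ℝ) / A * T) ^ βi / ((η : ℝ) / A) ≤ 2 * B * regretRate β T A := by
      -- Since `ρT` may be below `1`, monotonicity in the exponent can fail; the extra `1` costs one
      -- `A / η`, hence the factor `2`.
      have h0 := rpow_le_one_add_rpow (by positivity : 0 ≤ (η : ℝ) / A * T) hβi0 hβi
      rw [div_eq_mul_inv, inv_div]
      have := mul_le_mul_of_nonneg_right h0 (by positivity : 0 ≤ A / (η : ℝ))
      linarith
    have := mul_le_mul_of_nonneg_left hpow hK.le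
    unfold algRegret at hreg
    unfold metaRegret
    linarith
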